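/- Let $n$ be a positive integer, $K=[-1,1]^n$, let $\lambda\ge -\tfrac12$, and equip $K$ with the measure $d\mu(x)=\prod_{i=1}^n(1-x_i^2)^{\lambda}\,dx$. For a polynomial $f\in\mathbb R[x_1,\dots,x_n]$ and an integer $r\ge 1$ put $f_{\min}=\min_{x\in K}f(x)$ and $$f^{(r)}=\inf\Big\{\int_K f\,q\,d\mu \;:\; q \text{ a sum of squares of real polynomials},\ \deg q\le 2r,\ \int_K q\,d\mu=1\Big\}.$$ Put also $\beta_f=\max_{x\in K}\|\nabla f(x)\|$ and $\gamma_f=\tfrac12\max_{x\in K}\|\nabla^2 f(x)\|$ (Euclidean norm and spectral norm, respectively). If $a\in K$ is a global minimizer of $f$ on $K$, then $$f^{(r)}-f_{\min}=O_a\!\left(\frac1{r^2}\right);$$ that is, for every $n$, $\lambda$, $a\in K$ and all reals $\beta,\gamma$ there is a constant $c>0$, depending only on $n,\lambda,a,\beta,\gamma$, such that for every polynomial $f$ that has $a$ as a global minimizer on $K$ and satisfies $\beta_f=\beta$, $\gamma_f=\gamma$, $$f^{(r)}-f_{\min}\le \frac{c}{r^2}\qquad\text{for all integers } r\ge 1 .$$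 -/

import Mathlib

open MeasureTheory

noncomputable section

namespace Lasserre

/-- The polynomial function on Euclidean space `ℝⁿ` attached to an `n`-variate polynomial. -/
def polyFun {n : ℕ} (f : MvPolynomial (Fin n) ℝ) (x : EuclideanSpace ℝ (Fin n)) : ℝ :=
  MvPolynomial.eval (fun i => x i) f

/-- `Σ_r`: the sums of squares of real polynomials that have degree at most `2 r`. -/
def sosPolys (n r : ℕ) : Set (MvPolynomial (Fin n) ℝ) :=
  {q | IsSumSq q ∧ q.totalDegree ≤ 2 * r}

/-- `f_min`, the minimum of `f` on `K`. -/
def minValue {n : ℕ} (K : Set (EuclideanSpace ℝ (Fin n))) (f : MvPolynomial (Fin n) ℝ) : ℝ :=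
  sInf (polyFun f '' K)

/-- Lasserre's measure-based upper bound `f^{(r)}` for `K` and the reference measure `μ`:
the infimum of `∫_K f q dμ` over all `q ∈ Σ_r` with `∫_K q dμ = 1`. -/
def upperBound {n : ℕ} (K : Set (EuclideanSpace ℝ (Fin n)))
    (μ : Measure (EuclideanSpace ℝ (Fin n))) (f : MvPolynomial (Fin n) ℝ) (r : ℕ) : ℝ :=
  sInf {v : ℝ | ∃ q ∈ sosPolys n r, (∫ x in K, polyFun q x ∂μ) = 1 ∧
    v = ∫ x in K, polyFun f x * polyFun q x ∂μ}

/-- The error `E^{(r)}(f) = f^{(r)} - f_min`. -/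
def ubError {n : ℕ} (K : Set (EuclideanSpace ℝ (Fin n)))
    (μ : Measure (EuclideanSpace ℝ (Fin n))) (f : MvPolynomial (Fin n) ℝ) (r : ℕ) : ℝ :=
  upperBound K μ f r - minValue K f

/-- `β_{K,f} = max_{x ∈ K} ‖∇ f(x)‖`. -/
def gradConst {n : ℕ} (K : Set (EuclideanSpace ℝ (Fin n))) (f : MvPolynomial (Fin n) ℝ) : ℝ :=
  sSup ((fun x => ‖gradient (polyFun f) x‖) '' K)

/-- `γ_{K,f} = (1/2) max_{x ∈ K} ‖∇² f(x)‖`; the Hessian is the derivative of the gradient,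
and its norm is the operator (spectral) norm. -/
def hessConst {n : ℕ} (K : Set (EuclideanSpace ℝ (Fin n))) (f : MvPolynomial (Fin n) ℝ) : ℝ :=
  1 / 2 * sSup ((fun x => ‖fderiv ℝ (gradient (polyFun f)) x‖) '' K)

/-- The hypercube `[-1, 1]ⁿ`. -/
def box (n : ℕ) : Set (EuclideanSpace ℝ (Fin n)) :=
  {x | ∀ i, x i ∈ Set.Icc (-1 : ℝ) 1}

/-- The measure `∏ᵢ (1 - xᵢ²)^l dx` on the hypercube. For `l < 0` the value of the density on
the boundary of the hypercube is immaterial, the boundary being a null set. -/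
def boxMeasure (n : ℕ) (l : ℝ) : Measure (EuclideanSpace ℝ (Fin n)) :=
  (volume.restrict (box n)).withDensity
    (fun x => ENNReal.ofReal (∏ i, (1 - x i ^ 2) ^ l))

end Lasserre

end

noncomputable section

namespace Lasserre

/-! It suffices to find squares of degree at most `2 * r` whose mass concentrates near `a`. Distance
to `a` is measured by a quadratic polynomial `h` (`boxGauge a`), linear in the coordinates where `a
i = ±1` and quadratic in the others. Minimality kills the partial derivatives in the interior
coordinates, so `f - f(a) ≤ const * h` on the box (`polyFun_sub_le_boxGauge`), with a constant
depending only on the gradient bound, the Hessian bound and `n`.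

The Fejér kernel `Q = (1 - T_m) / (1 - X)`, evaluated at `1 - h` and divided by `m ^ 2`, gives a
polynomial `g` with `0 ≤ g ≤ min 1 (2 / (m ^ 2 * h))` and `g ≥ 1 / 4` where `h ≤ 1 / m ^ 2`
(`exists_fejer_polynomial`). The sublevel sets of `h` are doubling for the measure
(`boxMeasure_boxGauge_doubling`), so a fixed power `g ^ (2 * s)` decays fast enough over dyadic
shells to beat their growth, and the mean of `h` against it is `O(1 / m ^ 2)`
(`exists_integral_mul_pow_le`). With `m` of order `r` the normalized power is admissible. Only `l >
-1` enters the argument. -/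

/-! ### Trigonometric estimates and the Fejér kernel. -/

theorem abs_sin_nat_mul_le (m : ℕ) (x : ℝ) : |Real.sin (m * x)| ≤ m * |Real.sin x| := by
  induction m with
  | zero => simp
  | succ k ih =>
    have h1 : Real.sin ((k + 1 : ℕ) * x)
        = Real.sin (k * x) * Real.cos x + Real.cos (k * x) * Real.sin x := by
      rw [← Real.sin_add]; push_cast; ring_nf
    rw [h1]
    calc _ ≤ |Real.sin (k * x)| * |Real.cos x| + |Real.cos (k * x)| * |Real.sin x| := by
          rw [← abs_mul, ← abs_mul]; exact abs_add_le _ _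
      _ ≤ k * |Real.sin x| * 1 + 1 * |Real.sin x| := by
          gcongr
          · exact Real.abs_cos_le_one x
          · exact Real.abs_cos_le_one _
      _ = _ := by push_cast; ring

/-- Half-angle form of the sine bound; it yields `Q ≤ m ^ 2` for the Fejér kernel. -/
theorem one_sub_cos_nat_mul_le (m : ℕ) (x : ℝ) :
    1 - Real.cos (m * x) ≤ (m : ℝ) ^ 2 * (1 - Real.cos x) := by
  have key (y : ℝ) : 1 - Real.cos y = 2 * |Real.sin (y / 2)| ^ 2 := by
    have h := Real.cos_sq (y / 2)
    rw [mul_div_cancel₀ y (two_ne_zero' ℝ)] at h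
    have h2 := Real.sin_sq_add_cos_sq (y / 2)
    rw [sq_abs]; linarith
  rw [key, key, mul_div_assoc]
  have h := pow_le_pow_left₀ (abs_nonneg _) (abs_sin_nat_mul_le m (x / 2)) 2
  rw [mul_pow] at h
  linarith

/-- If `1 - cos θ ≤ 1 / m ^ 2`, then `1 - cos (m θ)` is comparable to `m ^ 2 (1 - cos θ)`. -/
theorem le_one_sub_cos_nat_mul {m : ℕ} (hm : 1 ≤ m) {x : ℝ} (hx : |x| ≤ Real.pi)
    (h : 1 - Real.cos x ≤ 1 / (m : ℝ) ^ 2) :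
    (m : ℝ) ^ 2 / 4 * (1 - Real.cos x) ≤ 1 - Real.cos (m * x) := by
  have hpi := Real.pi_pos
  have hm' : (0 : ℝ) < m := by exact_mod_cast hm
  have h1 := Real.cos_le_one_sub_mul_cos_sq hx
  -- The hypothesis on `cos x` keeps `m * x` within `[-π, π]`, where the quadratic upper bound for
  -- cosine is available again.
  have h2 : ((m : ℝ) * x) ^ 2 ≤ Real.pi ^ 2 := by
    have h3 : 2 / Real.pi ^ 2 * x ^ 2 ≤ 1 / (m : ℝ) ^ 2 := by linarith
    rw [div_mul_eq_mul_div, div_le_div_iff₀ (by positivity) (by positivity)] at h3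
    nlinarith [sq_nonneg (m * x)]
  have h4 := Real.cos_le_one_sub_mul_cos_sq (abs_le_of_sq_le_sq h2 hpi.le)
  have h5 : 1 - Real.cos x ≤ x ^ 2 / 2 := by linarith [Real.one_sub_sq_div_two_le_cos (x := x)]
  have h6 : 1 / 16 ≤ 1 / Real.pi ^ 2 := by
    apply one_div_le_one_div_of_le (by positivity)
    nlinarith [Real.pi_le_four]
  calc (m : ℝ) ^ 2 / 4 * (1 - Real.cos x) ≤ (m : ℝ) ^ 2 / 4 * (x ^ 2 / 2) := by gcongr
    _ = 1 / 16 * (2 * (m * x) ^ 2) := by ring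
    _ ≤ 1 / Real.pi ^ 2 * (2 * (m * x) ^ 2) := by gcongr
    _ = 2 / Real.pi ^ 2 * (m * x) ^ 2 := by ring
    _ ≤ _ := by linarith

open Polynomial Polynomial.Chebyshev in
/-- The Fejér kernel `(1 - T_m) / (1 - X)` as an algebraic polynomial. -/
theorem exists_fejer_polynomial {m : ℕ} (hm : 1 ≤ m) :
    ∃ Q : Polynomial ℝ, Q.natDegree ≤ m - 1 ∧ ∀ y ∈ Set.Icc (-1 : ℝ) 1,
      0 ≤ Q.eval y ∧ Q.eval y ≤ (m : ℝ) ^ 2 ∧ Q.eval y * (1 - y) ≤ 2 ∧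
      (1 - y ≤ 1 / (m : ℝ) ^ 2 → (m : ℝ) ^ 2 / 4 ≤ Q.eval y) := by
  obtain ⟨Q, hQ⟩ : (X - C (1 : ℝ)) ∣ T ℝ m - 1 := by
    rw [dvd_iff_isRoot]; simp
  have hm' : (0 : ℝ) < m := by exact_mod_cast hm
  have hval (y : ℝ) : Q.eval y * (1 - y) = 1 - (T ℝ m).eval y := by
    have := congrArg (eval y) hQ
    simp only [eval_sub, eval_one, eval_mul, eval_X, eval_C] at this
    linarith
  -- At `y = 1` the quotient is `0 / 0`; differentiating the factorization gives `Q(1) = T_m'(1) = m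
  -- ^ 2`.
  have hone : Q.eval 1 = (m : ℝ) ^ 2 := by
    have := congrArg (fun p => eval 1 (derivative p)) hQ
    simp only [derivative_mul, derivative_sub, derivative_X, derivative_C, derivative_one,
      eval_add, eval_mul, eval_sub, eval_X, eval_C, eval_one, eval_zero, derivative_T_eval_one]
      at this
    push_cast at this
    linarith
  refine ⟨Q, ?_, fun y hy => ?_⟩
  · have hdeg : (T ℝ m - 1).natDegree ≤ m := by
      refine (natDegree_sub_le _ _).trans ?_
      simp
    rcases eq_or_ne Q 0 with h0 | h0
    · simp [h0]
    · rw [hQ, natDegree_mul (X_sub_C_ne_zero 1) h0, natDegree_X_sub_C] at hdeg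
      omega
  · have hcos : Real.cos (Real.arccos y) = y := Real.cos_arccos hy.1 hy.2
    have hT : (T ℝ m).eval y = Real.cos (m * Real.arccos y) := by
      have := T_real_cos (Real.arccos y) m
      rwa [hcos] at this
    have h2 : Q.eval y * (1 - y) ≤ 2 := by
      rw [hval, hT]; linarith [Real.neg_one_le_cos (m * Real.arccos y)]
    rcases eq_or_lt_of_le hy.2 with rfl | hlt
    · rw [hone] at h2 ⊢
      exact ⟨by positivity, le_rfl, h2, fun _ => by nlinarith⟩
    · have hpos : 0 < 1 - y := by linarith
      refine ⟨?_, ?_, h2, fun h => ?_⟩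
      · refine nonneg_of_mul_nonneg_left ?_ hpos
        rw [hval, hT]; linarith [Real.cos_le_one (m * Real.arccos y)]
      · refine le_of_mul_le_mul_right ?_ hpos
        rw [hval, hT]
        have := one_sub_cos_nat_mul_le m (Real.arccos y)
        rwa [hcos] at this
      · refine le_of_mul_le_mul_right ?_ hpos
        rw [hval, hT]
        have := le_one_sub_cos_nat_mul hm (x := Real.arccos y)
          (by rw [abs_of_nonneg (Real.arccos_nonneg y)]; exact Real.arccos_le_pi y)
          (by rwa [hcos])
        rwa [hcos] at this

/-! ### Concentration of kernel powers under doubling. -/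

theorem measureReal_le_two_pow_mul {Ω : Type*} [MeasurableSpace Ω] {μ : Measure Ω} {h : Ω → ℝ}
    {D : ℝ} (hD : 1 ≤ D)
    (hdoub : ∀ t > 0, μ.real {x | h x ≤ 2 * t} ≤ D * μ.real {x | h x ≤ t}) {t : ℝ} (ht : 0 < t)
    (j : ℕ) : μ.real {x | h x ≤ 2 ^ j * t} ≤ D ^ j * μ.real {x | h x ≤ t} := by
  induction j with
  | zero => simp
  | succ k ih =>
    calc μ.real {x | h x ≤ 2 ^ (k + 1) * t} = μ.real {x | h x ≤ 2 * (2 ^ k * t)} := by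
          congr; ext; rw [pow_succ]; ring_nf
      _ ≤ D * μ.real {x | h x ≤ 2 ^ k * t} := hdoub _ (by positivity)
      _ ≤ D * (D ^ k * μ.real {x | h x ≤ t}) := by gcongr
      _ = _ := by ring

/-- If the sublevel sets of `h` are doubling, then kernels `g` that are at least `1 / 4` where
`h ≤ δ` and at most `min 1 (2 δ / h)` have powers concentrating on `h ≲ δ`. -/
theorem exists_integral_mul_pow_le {Ω : Type*} [MeasurableSpace Ω] {μ : Measure Ω}
    [IsFiniteMeasure μ] {h : Ω → ℝ} (hm : Measurable h)
    (h02 : ∀ᵐ x ∂μ, 0 ≤ h x ∧ h x ≤ 2) {D : ℝ} (hD : 1 ≤ D)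
    (hdoub : ∀ t > 0, μ.real {x | h x ≤ 2 * t} ≤ D * μ.real {x | h x ≤ t}) :
    ∃ s : ℕ, 1 ≤ s ∧ ∃ C > 0, ∀ δ > 0, ∀ g : Ω → ℝ, Measurable g →
      (∀ᵐ x ∂μ, 0 ≤ g x ∧ g x ≤ 1 ∧ g x * h x ≤ 2 * δ ∧ (h x ≤ δ → 1 / 4 ≤ g x)) →
      ∫ x, h x * g x ^ (2 * s) ∂μ ≤ C * δ * ∫ x, g x ^ (2 * s) ∂μ ∧
      (1 / 4) ^ (2 * s) * μ.real {x | h x ≤ δ} ≤ ∫ x, g x ^ (2 * s) ∂μ := by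
  -- Since `2 ^ (2 * s) = 4 ^ s`, this choice makes the ratio `D * 2 / 2 ^ (2 * s)` of the geometric
  -- series below at most `1 / 2`.
  obtain ⟨s, hs⟩ := pow_unbounded_of_one_lt (4 * D) (by norm_num : (1 : ℝ) < 4)
  have hs1 : 1 ≤ s := by
    by_contra hcon
    have : s = 0 := by omega
    subst this
    linarith [pow_zero (4 : ℝ)]
  -- One factor `4 ^ (2 * s)` comes from the shell bound `g ≤ 4 / 2 ^ j`, the other from `g ≥ 1 / 4`
  -- on the core; the `2` is the geometric sum.
  refine ⟨s, hs1, 2 * 4 ^ (2 * s) * 4 ^ (2 * s), by positivity, fun δ hδ g hg hgh => ?_⟩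
  set N := 2 * s with hN
  have h2N : 4 * D ≤ 2 ^ N := by rw [hN, pow_mul]; norm_num; exact hs.le
  have hmeas (t : ℝ) : MeasurableSet {x | h x ≤ t} := measurableSet_le hm measurable_const
  have hgint : Integrable (fun x => g x ^ N) μ := by
    refine Integrable.of_bound (hg.pow_const N).aestronglyMeasurable 1 ?_
    filter_upwards [hgh] with x hx
    rw [Real.norm_of_nonneg (pow_nonneg hx.1 _)]
    exact pow_le_one₀ hx.1 hx.2.1
  have hlow : (1 / 4) ^ N * μ.real {x | h x ≤ δ} ≤ ∫ x, g x ^ N ∂μ := by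
    calc (1 / 4) ^ N * μ.real {x | h x ≤ δ}
        = ∫ x, {x | h x ≤ δ}.indicator (fun _ => (1 / 4 : ℝ) ^ N) x ∂μ := by
          rw [integral_indicator_const _ (hmeas δ), smul_eq_mul, mul_comm]
      _ ≤ _ := by
          refine integral_mono_ae ((integrable_const _).indicator (hmeas δ)) hgint ?_
          filter_upwards [hgh] with x hx
          by_cases hxδ : h x ≤ δ
          · rw [Set.indicator_of_mem (show x ∈ {x | h x ≤ δ} from hxδ)]
            exact pow_le_pow_left₀ (by norm_num) (hx.2.2.2 hxδ) N
          · rw [Set.indicator_of_notMem (show x ∉ {x | h x ≤ δ} from hxδ)]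
            exact pow_nonneg hx.1 _
  refine ⟨?_, hlow⟩
  -- Because `h ≤ 2`, finitely many dyadic shells suffice.
  obtain ⟨J, hJ⟩ := pow_unbounded_of_one_lt (2 / δ) (by norm_num : (1 : ℝ) < 2)
  have hJ2 : 2 < 2 ^ J * δ := by rwa [div_lt_iff₀ hδ] at hJ
  -- The `j`-th coefficient is `(2 ^ j * δ) * (4 / 2 ^ j) ^ N`, the bound for `h * g ^ N` on the
  -- shell `2 ^ (j - 1) * δ < h ≤ 2 ^ j * δ`.
  set F : Ω → ℝ := fun x => ∑ j ∈ Finset.range (J + 1),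
    {x | h x ≤ 2 ^ j * δ}.indicator (fun _ => 4 ^ N * δ * (2 / 2 ^ N : ℝ) ^ j) x with hF
  have hFint : Integrable F μ :=
    integrable_finsetSum _ fun j _ => (integrable_const _).indicator (hmeas _)
  have hterm (x : Ω) (j : ℕ) :
      0 ≤ {x | h x ≤ 2 ^ j * δ}.indicator (fun _ => 4 ^ N * δ * (2 / 2 ^ N : ℝ) ^ j) x :=
    Set.indicator_nonneg (fun _ _ => by positivity) x
  have hpt : ∀ᵐ x ∂μ, h x * g x ^ N ≤ F x := by
    filter_upwards [hgh, h02] with x hx h02x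
    obtain ⟨g0, g1, gh, -⟩ := hx
    have hex : ∃ j, h x ≤ 2 ^ j * δ := ⟨J, h02x.2.trans hJ2.le⟩
    classical
    set j := Nat.find hex with hj
    have hj1 : h x ≤ 2 ^ j * δ := Nat.find_spec hex
    have hjJ : j ≤ J := Nat.find_min' hex (h02x.2.trans hJ2.le)
    have hle : h x * g x ^ N ≤ 4 ^ N * δ * (2 / 2 ^ N : ℝ) ^ j := by
      rcases Nat.eq_zero_or_pos j with h0 | hpos
      · rw [h0] at hj1 ⊢
        simp only [pow_zero, one_mul, mul_one] at hj1 ⊢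
        calc h x * g x ^ N ≤ δ * 1 := by
              gcongr
              exact pow_le_one₀ g0 g1
          _ ≤ 4 ^ N * δ := by
              rw [mul_comm]; gcongr; exact one_le_pow₀ (by norm_num)
      · have hj2 : ¬ h x ≤ 2 ^ (j - 1) * δ := Nat.find_min hex (by omega)
        push Not at hj2
        have h2j : (2 : ℝ) ^ j = 2 * 2 ^ (j - 1) := by
          rw [← pow_succ']; congr 1; omega
        have hgj : g x ≤ 4 / 2 ^ j := by
          rw [h2j]
          have h3 : g x * (2 ^ (j - 1) * δ) ≤ 2 * δ :=
            (mul_le_mul_of_nonneg_left hj2.le g0).trans gh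
          have h4 : g x * 2 ^ (j - 1) ≤ 2 := by
            refine le_of_mul_le_mul_right ?_ hδ
            linarith
          rw [le_div_iff₀ (by positivity)]
          linarith
        calc h x * g x ^ N ≤ (2 ^ j * δ) * (4 / 2 ^ j) ^ N := by gcongr
          _ = _ := by
            rw [div_pow, div_pow, ← pow_mul, ← pow_mul, mul_comm j N]; ring
    refine hle.trans ?_
    have : 4 ^ N * δ * (2 / 2 ^ N : ℝ) ^ j
        = {x | h x ≤ 2 ^ j * δ}.indicator (fun _ => 4 ^ N * δ * (2 / 2 ^ N : ℝ) ^ j) x := by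
      rw [Set.indicator_of_mem (show x ∈ {x | h x ≤ 2 ^ j * δ} from hj1)]
    rw [this]
    exact Finset.single_le_sum (f := fun j => {x | h x ≤ 2 ^ j * δ}.indicator
      (fun _ => 4 ^ N * δ * (2 / 2 ^ N : ℝ) ^ j) x) (fun i _ => hterm x i)
      (Finset.mem_range.2 (by omega))
  have hint : Integrable (fun x => h x * g x ^ N) μ := by
    refine hFint.mono' (hm.mul (hg.pow_const N)).aestronglyMeasurable ?_
    filter_upwards [hpt, hgh, h02] with x hx hx2 hx3
    rwa [Real.norm_of_nonneg (mul_nonneg hx3.1 (pow_nonneg hx2.1 _))]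
  have hV := measureReal_nonneg (μ := μ) (s := {x | h x ≤ δ})
  calc ∫ x, h x * g x ^ N ∂μ ≤ ∫ x, F x ∂μ := integral_mono_ae hint hFint hpt
    _ = ∑ j ∈ Finset.range (J + 1),
          μ.real {x | h x ≤ 2 ^ j * δ} * (4 ^ N * δ * (2 / 2 ^ N : ℝ) ^ j) := by
        rw [hF, integral_finsetSum _ fun j _ => (integrable_const _).indicator (hmeas _)]
        refine Finset.sum_congr rfl fun j _ => ?_
        rw [integral_indicator_const _ (hmeas _), smul_eq_mul]
    _ ≤ ∑ j ∈ Finset.range (J + 1), (4 ^ N * δ * μ.real {x | h x ≤ δ}) * (1 / 2 : ℝ) ^ j := by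
        refine Finset.sum_le_sum fun j _ => ?_
        calc _ ≤ (D ^ j * μ.real {x | h x ≤ δ}) * (4 ^ N * δ * (2 / 2 ^ N : ℝ) ^ j) := by
              gcongr
              exact measureReal_le_two_pow_mul hD hdoub hδ j
          _ = (4 ^ N * δ * μ.real {x | h x ≤ δ}) * (D * (2 / 2 ^ N)) ^ j := by
              rw [mul_pow]; ring
          _ ≤ _ := by
              gcongr
              rw [mul_div_assoc', div_le_div_iff₀ (by positivity) (by norm_num)]
              linarith
    _ ≤ (4 ^ N * δ * μ.real {x | h x ≤ δ}) * 2 := by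
        rw [← Finset.mul_sum]
        gcongr
        exact sum_geometric_two_le _
    _ = 2 * 4 ^ N * 4 ^ N * δ * ((1 / 4) ^ N * μ.real {x | h x ≤ δ}) := by
        have : (4 : ℝ) ^ N * (1 / 4) ^ N = 1 := by rw [← mul_pow]; norm_num
        linear_combination (-2 * 4 ^ N * δ * μ.real {x | h x ≤ δ}) * this
    _ ≤ _ := by gcongr

/-! ### The univariate weight and its integrability. -/

/-- The univariate weight `(1 - x²)^l`. -/
def weight (l x : ℝ) : ℝ := (1 - x ^ 2) ^ l

theorem measurable_weight (l : ℝ) : Measurable (weight l) := by unfold weight; fun_prop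

theorem weight_neg (l x : ℝ) : weight l (-x) = weight l x := by simp [weight]

theorem weight_nonneg (l : ℝ) {x : ℝ} (hx : x ∈ Set.Icc (-1 : ℝ) 1) : 0 ≤ weight l x :=
  Real.rpow_nonneg (by nlinarith [hx.1, hx.2]) l

theorem weight_eq_mul (l : ℝ) {x : ℝ} (hx : x ∈ Set.Icc (-1 : ℝ) 1) :
    weight l x = (1 - x) ^ l * (1 + x) ^ l := by
  rw [weight, ← Real.mul_rpow (by linarith [hx.2]) (by linarith [hx.1])]
  ring_nf

theorem rpow_mem_Icc_two_rpow_abs (l : ℝ) {y : ℝ} (hy : y ∈ Set.Icc (1 : ℝ) 2) :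
    y ^ l ∈ Set.Icc ((2 : ℝ) ^ (-|l|)) (2 ^ |l|) := by
  have h0 : 0 < y := by linarith [hy.1]
  have h1 : y ^ |l| ≤ 2 ^ |l| := Real.rpow_le_rpow h0.le hy.2 (abs_nonneg l)
  constructor
  · calc (2 : ℝ) ^ (-|l|) = (2 ^ |l|)⁻¹ := Real.rpow_neg (by norm_num) _
      _ ≤ (y ^ |l|)⁻¹ := by gcongr
      _ = y ^ (-|l|) := (Real.rpow_neg h0.le _).symm
      _ ≤ y ^ l := Real.rpow_le_rpow_of_exponent_le hy.1 (neg_abs_le l)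
  · exact (Real.rpow_le_rpow_of_exponent_le hy.1 (le_abs_self l)).trans h1

/-- On this half of the interval `1 + x` lies in `[1, 2]`, so only the singularity at `1` matters.
The exponents `±|l|` cover both signs of `l`. -/
theorem weight_bounds (l : ℝ) {x : ℝ} (hx : x ∈ Set.Icc (0 : ℝ) 1) :
    2 ^ (-|l|) * (1 - x) ^ l ≤ weight l x ∧ weight l x ≤ 2 ^ |l| * (1 - x) ^ l := by
  rw [weight_eq_mul l ⟨by linarith [hx.1], hx.2⟩, mul_comm ((1 - x) ^ l)]
  have h := rpow_mem_Icc_two_rpow_abs l (y := 1 + x) ⟨by linarith [hx.1], by linarith [hx.2]⟩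
  have h0 : 0 ≤ (1 - x) ^ l := Real.rpow_nonneg (by linarith [hx.2]) l
  exact ⟨mul_le_mul_of_nonneg_right h.1 h0, mul_le_mul_of_nonneg_right h.2 h0⟩

theorem intervalIntegrable_one_sub_rpow {l : ℝ} (hl : -1 < l) (a b : ℝ) :
    IntervalIntegrable (fun x : ℝ => (1 - x) ^ l) volume a b := by
  simpa using
    (intervalIntegral.intervalIntegrable_rpow' (a := 1 - a) (b := 1 - b) hl).comp_sub_left 1

theorem integrableOn_weight {l : ℝ} (hl : -1 < l) :
    IntegrableOn (weight l) (Set.Icc (-1) 1) := by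
  have h1 : IntegrableOn (fun x : ℝ => (1 - x) ^ l) (Set.Icc (-1) 1) :=
    (intervalIntegrable_iff_integrableOn_Icc_of_le (by norm_num)).1
      (intervalIntegrable_one_sub_rpow hl (-1) 1)
  have h2 : IntegrableOn (fun x : ℝ => (1 + x) ^ l) (Set.Icc (-1) 1) := by
    have := (intervalIntegral.intervalIntegrable_rpow' (a := 0) (b := 2) hl).comp_add_left 1
    norm_num at this
    exact (intervalIntegrable_iff_integrableOn_Icc_of_le (by norm_num)).1 this
  -- Each summand of the dominating function takes care of one endpoint.
  refine Integrable.mono' ((h1.add h2).const_mul (2 ^ |l|))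
    (measurable_weight l).aestronglyMeasurable ?_
  filter_upwards [ae_restrict_mem measurableSet_Icc] with x hx
  rw [Real.norm_of_nonneg (weight_nonneg l hx)]
  have hp1 : 0 ≤ (1 - x) ^ l := Real.rpow_nonneg (by linarith [hx.2]) l
  have hp2 : 0 ≤ (1 + x) ^ l := Real.rpow_nonneg (by linarith [hx.1]) l
  have hp : (0 : ℝ) ≤ 2 ^ |l| := by positivity
  simp only [Pi.add_apply, mul_add]
  rcases le_total 0 x with h0 | h0
  · have := (weight_bounds l ⟨h0, hx.2⟩).2
    nlinarith [mul_nonneg hp hp2]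
  · have := (weight_bounds l (x := -x) ⟨by linarith, by linarith [hx.1]⟩).2
    rw [weight_neg, sub_neg_eq_add] at this
    nlinarith [mul_nonneg hp hp1]

/-! ### Doubling of sublevel masses on the interval. -/

/-- The mass of the sublevel set `{h ≤ t}` in `[-1, 1]` for the weight `(1 - x²)^l`. -/
def sublevelMass (l : ℝ) (h : ℝ → ℝ) (t : ℝ) : ℝ :=
  ∫ x in {x | x ∈ Set.Icc (-1 : ℝ) 1 ∧ h x ≤ t}, weight l x

theorem sublevelMass_mono {l : ℝ} (hl : -1 < l) {h : ℝ → ℝ} (hm : Measurable h) :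
    Monotone (sublevelMass l h) := by
  intro s t hst
  have hms : MeasurableSet {x | x ∈ Set.Icc (-1 : ℝ) 1 ∧ h x ≤ t} :=
    measurableSet_Icc.inter (measurableSet_le hm measurable_const)
  refine setIntegral_mono_set ((integrableOn_weight hl).mono_set fun x hx => hx.1) ?_
    (Filter.Eventually.of_forall fun x hx => ⟨hx.1, hx.2.trans hst⟩)
  filter_upwards [ae_restrict_mem hms] with x hx using weight_nonneg l hx.1

theorem sublevelMass_le {l : ℝ} (hl : -1 < l) (h : ℝ → ℝ) (t : ℝ) :
    sublevelMass l h t ≤ ∫ x in Set.Icc (-1 : ℝ) 1, weight l x := by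
  refine setIntegral_mono_set (integrableOn_weight hl) ?_
    (Filter.Eventually.of_forall fun x hx => hx.1)
  filter_upwards [ae_restrict_mem measurableSet_Icc] with x hx using weight_nonneg l hx

/-- For small `t` the power law gives doubling directly; for larger `t` the total mass `T` is
compared with the positive value `v (t₀ / 2)`. -/
theorem exists_doubling_of_rpow_bounds {v : ℝ → ℝ} (hv : Monotone v) {T : ℝ} (hT : ∀ t, v t ≤ T)
    {c C d t₀ : ℝ} (hc : 0 < c) (ht₀ : 0 < t₀)
    (hb : ∀ t, 0 < t → t ≤ t₀ → c * t ^ d ≤ v t ∧ v t ≤ C * t ^ d) :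
    (∀ t > 0, 0 < v t) ∧ ∃ D, 1 ≤ D ∧ ∀ t > 0, v (2 * t) ≤ D * v t := by
  have hpos (t : ℝ) (ht : 0 < t) : 0 < v t := by
    have h1 := (hb (min t t₀) (lt_min ht ht₀) (min_le_right _ _)).1
    have h2 := hv (min_le_left t t₀)
    have h3 : 0 < c * (min t t₀) ^ d := by have := lt_min ht ht₀; positivity
    linarith
  refine ⟨hpos, max 1 (max (C * 2 ^ d / c) (T / v (t₀ / 2))), le_max_left _ _, fun t ht => ?_⟩
  rcases le_total t (t₀ / 2) with h | h
  · have h1 := (hb (2 * t) (by positivity) (by linarith)).2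
    have h2 := (hb t ht (by linarith)).1
    -- Positivity of `C` is not assumed; it is forced by positivity of `v`.
    have hC : 0 < C * 2 ^ d := by
      have := hpos _ (by positivity : 0 < 2 * t)
      by_contra hcon
      rw [Real.mul_rpow (by norm_num) ht.le] at h1
      have := mul_nonneg (neg_nonneg.2 (not_lt.1 hcon)) (Real.rpow_nonneg ht.le d)
      linarith
    calc v (2 * t) ≤ C * (2 * t) ^ d := h1
      _ = C * 2 ^ d / c * (c * t ^ d) := by
        rw [Real.mul_rpow (by norm_num) ht.le]; field_simp
      _ ≤ C * 2 ^ d / c * v t := by gcongr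
      _ ≤ _ := by
        have := (hpos t ht).le
        gcongr
        exact (le_max_left _ _).trans (le_max_right _ _)
  · have hp := hpos (t₀ / 2) (by positivity)
    calc v (2 * t) ≤ T := hT _
      _ = T / v (t₀ / 2) * v (t₀ / 2) := by field_simp
      _ ≤ T / v (t₀ / 2) * v t := by
        have : 0 ≤ T := (hp.le).trans (hT _)
        gcongr
        exact hv h
      _ ≤ _ := by
        have := (hpos t ht).le
        gcongr
        exact (le_max_right _ _).trans (le_max_right _ _)

theorem integral_one_sub_rpow {l : ℝ} (hl : -1 < l) {t : ℝ} (ht : 0 < t) :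
    ∫ x in Set.Icc (1 - t) 1, (1 - x) ^ l = t ^ (l + 1) / (l + 1) := by
  rw [integral_Icc_eq_integral_Ioc, ← intervalIntegral.integral_of_le (by linarith),
    intervalIntegral.integral_comp_sub_left (fun x => x ^ l) 1, integral_rpow (Or.inl hl)]
  rw [sub_self, sub_sub_cancel, Real.zero_rpow (by linarith), sub_zero]

theorem sublevelMass_doubling_one {l : ℝ} (hl : -1 < l) :
    (∀ t > 0, 0 < sublevelMass l (fun x => 1 - x) t) ∧ ∃ D, 1 ≤ D ∧ ∀ t > 0,
      sublevelMass l (fun x => 1 - x) (2 * t) ≤ D * sublevelMass l (fun x => 1 - x) t := by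
  have hl1 : 0 < l + 1 := by linarith
  refine exists_doubling_of_rpow_bounds (sublevelMass_mono hl (by fun_prop))
    (sublevelMass_le hl _) (c := 2 ^ (-|l|) / (l + 1)) (C := 2 ^ |l| / (l + 1)) (d := l + 1)
    (t₀ := 1) (by positivity) one_pos fun t ht ht1 => ?_
  have hset : {x : ℝ | x ∈ Set.Icc (-1 : ℝ) 1 ∧ 1 - x ≤ t} = Set.Icc (1 - t) 1 := by
    ext x
    simp only [Set.mem_Icc, Set.mem_ofPred_eq]
    constructor
    · rintro ⟨⟨_, _⟩, _⟩; constructor <;> linarith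
    · rintro ⟨_, _⟩; refine ⟨⟨?_, ?_⟩, ?_⟩ <;> linarith
  have hw : IntegrableOn (weight l) (Set.Icc (1 - t) 1) :=
    (integrableOn_weight hl).mono_set (Set.Icc_subset_Icc_left (by linarith))
  have hp : IntegrableOn (fun x : ℝ => (1 - x) ^ l) (Set.Icc (1 - t) 1) :=
    (intervalIntegrable_iff_integrableOn_Icc_of_le (by linarith)).1
      (intervalIntegrable_one_sub_rpow hl _ _)
  have hint := integral_one_sub_rpow hl ht
  rw [sublevelMass, hset]
  constructor
  · calc _ = ∫ x in Set.Icc (1 - t) 1, 2 ^ (-|l|) * (1 - x) ^ l := by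
          rw [integral_const_mul, hint]; ring
      _ ≤ _ := setIntegral_mono_on (hp.const_mul _) hw measurableSet_Icc fun x hx =>
          (weight_bounds l ⟨by linarith [hx.1], hx.2⟩).1
  · calc _ ≤ ∫ x in Set.Icc (1 - t) 1, 2 ^ |l| * (1 - x) ^ l :=
          setIntegral_mono_on hw (hp.const_mul _) measurableSet_Icc fun x hx =>
          (weight_bounds l ⟨by linarith [hx.1], hx.2⟩).2
      _ = _ := by rw [integral_const_mul, hint]; ring

theorem sublevelMass_comp_neg (l : ℝ) {h : ℝ → ℝ} (hm : Measurable h) :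
    sublevelMass l (fun x => h (-x)) = sublevelMass l h := by
  funext t
  have hms : MeasurableSet {x | x ∈ Set.Icc (-1 : ℝ) 1 ∧ h x ≤ t} :=
    measurableSet_Icc.inter (measurableSet_le hm measurable_const)
  have hms' : MeasurableSet {x | x ∈ Set.Icc (-1 : ℝ) 1 ∧ h (-x) ≤ t} :=
    measurableSet_Icc.inter (measurableSet_le (hm.comp measurable_neg) measurable_const)
  rw [sublevelMass, sublevelMass, ← integral_indicator hms, ← integral_indicator hms',
    ← integral_neg_eq_self]
  congr 1
  funext x
  simp only [Set.indicator, Set.mem_ofPred_eq, Set.mem_Icc, neg_neg, weight_neg]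
  congr 1
  simp only [eq_iff_iff]
  constructor
  · rintro ⟨⟨_, _⟩, _⟩; refine ⟨⟨?_, ?_⟩, ?_⟩ <;> linarith
  · rintro ⟨⟨_, _⟩, _⟩; refine ⟨⟨?_, ?_⟩, ?_⟩ <;> linarith

/-- Near an interior point the weight is pinched between positive constants and the sublevel set is
an interval of half-length `√(2 * t)`, so the mass grows like `t ^ (1 / 2)`. -/
theorem sublevelMass_doubling_interior {l : ℝ} (hl : -1 < l) {a : ℝ} (ha : |a| < 1) :
    (∀ t > 0, 0 < sublevelMass l (fun x => (x - a) ^ 2 / 2) t) ∧ ∃ D, 1 ≤ D ∧ ∀ t > 0,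
      sublevelMass l (fun x => (x - a) ^ 2 / 2) (2 * t) ≤
        D * sublevelMass l (fun x => (x - a) ^ 2 / 2) t := by
  -- Half the distance from `a` to the endpoints, so the weight stays regular on `[a - ρ, a + ρ]`.
  set ρ := (1 - |a|) / 2 with hρ
  have hρ0 : 0 < ρ := by rw [hρ]; linarith
  have ha1 := le_abs_self a
  have ha2 := neg_abs_le a
  have hsub : Set.Icc (a - ρ) (a + ρ) ⊆ Set.Ioo (-1 : ℝ) 1 := fun x hx =>
    ⟨by linarith [hx.1], by linarith [hx.2]⟩
  have hpos (x : ℝ) (hx : x ∈ Set.Ioo (-1 : ℝ) 1) : 0 < 1 - x ^ 2 := by nlinarith [hx.1, hx.2]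
  have hcont : ContinuousOn (weight l) (Set.Icc (a - ρ) (a + ρ)) :=
    ContinuousOn.rpow_const (by fun_prop) fun x hx => Or.inl (hpos x (hsub hx)).ne'
  have hne : (Set.Icc (a - ρ) (a + ρ)).Nonempty := ⟨a, by linarith, by linarith⟩
  obtain ⟨y, hy, hmin⟩ := isCompact_Icc.exists_isMinOn hne hcont
  obtain ⟨z, hz, hmax⟩ := isCompact_Icc.exists_isMaxOn hne hcont
  have hmpos : 0 < weight l y := Real.rpow_pos_of_pos (hpos y (hsub hy)) l
  refine exists_doubling_of_rpow_bounds (sublevelMass_mono hl (by fun_prop))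
    (sublevelMass_le hl _) (c := weight l y * (2 * √2)) (C := weight l z * (2 * √2)) (d := 1 / 2)
    (t₀ := ρ ^ 2 / 2) (by positivity) (by positivity) fun t ht ht1 => ?_
  set u := √(2 * t) with hu
  have hu0 : 0 ≤ u := Real.sqrt_nonneg _
  have hu2 : u ^ 2 = 2 * t := Real.sq_sqrt (by positivity)
  have huρ : u ≤ ρ := Real.sqrt_le_iff.2 ⟨hρ0.le, by linarith⟩
  have hset : {x : ℝ | x ∈ Set.Icc (-1 : ℝ) 1 ∧ (x - a) ^ 2 / 2 ≤ t} = Set.Icc (a - u) (a + u) := by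
    ext x
    have hiff : (x - a) ^ 2 / 2 ≤ t ↔ |x - a| ≤ u := by
      rw [← abs_of_nonneg hu0, ← sq_le_sq, hu2]
      constructor <;> intro h <;> linarith
    simp only [Set.mem_Icc, Set.mem_ofPred_eq, hiff, abs_le]
    constructor
    · rintro ⟨_, _, _⟩; constructor <;> linarith
    · rintro ⟨_, _⟩; refine ⟨⟨?_, ?_⟩, ?_, ?_⟩ <;> linarith
  have hsub' : Set.Icc (a - u) (a + u) ⊆ Set.Icc (a - ρ) (a + ρ) :=
    Set.Icc_subset_Icc (by linarith) (by linarith)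
  have hw : IntegrableOn (weight l) (Set.Icc (a - u) (a + u)) :=
    (integrableOn_weight hl).mono_set fun x hx => Set.Ioo_subset_Icc_self (hsub (hsub' hx))
  have hvol (k : ℝ) : ∫ _ in Set.Icc (a - u) (a + u), k = k * (2 * √2) * t ^ (1 / 2 : ℝ) := by
    rw [setIntegral_const, measureReal_def, Real.volume_Icc, ENNReal.toReal_ofReal (by linarith),
      ← Real.sqrt_eq_rpow, smul_eq_mul, hu, Real.sqrt_mul (by norm_num)]
    ring
  rw [sublevelMass, hset, ← hvol, ← hvol]
  have hc (k : ℝ) : IntegrableOn (fun _ => k) (Set.Icc (a - u) (a + u)) :=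
    continuous_const.integrableOn_Icc
  exact ⟨setIntegral_mono_on (hc _) hw measurableSet_Icc fun x hx => hmin (hsub' hx),
    setIntegral_mono_on hw (hc _) measurableSet_Icc fun x hx => hmax (hsub' hx)⟩

/-- A polynomial gauge of the distance to `a` in `[-1, 1]`: linear if `a` is an endpoint and
quadratic otherwise. -/
def gauge (a x : ℝ) : ℝ := if |a| = 1 then 1 - a * x else (x - a) ^ 2 / 2

theorem continuous_gauge (a : ℝ) : Continuous (gauge a) := by
  unfold gauge; split_ifs <;> fun_prop

theorem gauge_nonneg {a x : ℝ} (hx : x ∈ Set.Icc (-1 : ℝ) 1) : 0 ≤ gauge a x := by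
  unfold gauge
  split_ifs with h
  · rcases eq_or_eq_neg_of_abs_eq h with rfl | rfl <;> linarith [hx.1, hx.2]
  · positivity

theorem gauge_le_two {a x : ℝ} (ha : a ∈ Set.Icc (-1 : ℝ) 1) (hx : x ∈ Set.Icc (-1 : ℝ) 1) :
    gauge a x ≤ 2 := by
  unfold gauge
  split_ifs with h
  · rcases eq_or_eq_neg_of_abs_eq h with rfl | rfl <;> linarith [hx.1, hx.2]
  · have : |x - a| ≤ 2 := abs_le.2 ⟨by linarith [hx.1, ha.2], by linarith [hx.2, ha.1]⟩
    nlinarith [sq_abs (x - a), abs_nonneg (x - a)]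

theorem sq_sub_le_two_mul_gauge {a x : ℝ} (hx : x ∈ Set.Icc (-1 : ℝ) 1) :
    (x - a) ^ 2 ≤ 2 * gauge a x := by
  unfold gauge
  split_ifs with h
  · rcases eq_or_eq_neg_of_abs_eq h with rfl | rfl <;> nlinarith [hx.1, hx.2]
  · linarith

theorem abs_sub_le_gauge {a x : ℝ} (ha : |a| = 1) (hx : x ∈ Set.Icc (-1 : ℝ) 1) :
    |x - a| ≤ gauge a x := by
  rw [gauge, if_pos ha, abs_le]
  rcases eq_or_eq_neg_of_abs_eq ha with rfl | rfl <;> constructor <;> linarith [hx.1, hx.2]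

theorem sublevelMass_gauge_doubling {l : ℝ} (hl : -1 < l) {a : ℝ} (ha : a ∈ Set.Icc (-1 : ℝ) 1) :
    (∀ t > 0, 0 < sublevelMass l (gauge a) t) ∧ ∃ D, 1 ≤ D ∧ ∀ t > 0,
      sublevelMass l (gauge a) (2 * t) ≤ D * sublevelMass l (gauge a) t := by
  by_cases h : |a| = 1
  · rcases eq_or_eq_neg_of_abs_eq h with rfl | rfl
    · have : gauge 1 = fun x => 1 - x := by funext x; simp [gauge]
      rw [this]
      exact sublevelMass_doubling_one hl
    · have : gauge (-1) = fun x => (fun y => 1 - y) (-x) := by funext x; simp [gauge]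
      rw [this, sublevelMass_comp_neg l (by fun_prop)]
      exact sublevelMass_doubling_one hl
  · have : gauge a = fun x => (x - a) ^ 2 / 2 := by funext x; simp [gauge, h]
    rw [this]
    exact sublevelMass_doubling_interior hl (lt_of_le_of_ne (abs_le.2 ha) h)

/-! ### The box and its product measure. -/

theorem isClosed_box (n : ℕ) : IsClosed (box n) := by
  have : box n = ⋂ i, {x | x i ∈ Set.Icc (-1 : ℝ) 1} := by ext; simp [box]
  rw [this]
  exact isClosed_iInter fun i => isClosed_Icc.preimage (by fun_prop)

theorem isCompact_box (n : ℕ) : IsCompact (box n) := by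
  refine Metric.isCompact_of_isClosed_isBounded (isClosed_box n) ?_
  refine (Metric.isBounded_iff_subset_closedBall 0).2 ⟨√n, fun x hx => ?_⟩
  rw [mem_closedBall_zero_iff, EuclideanSpace.norm_eq]
  refine Real.sqrt_le_sqrt ?_
  calc ∑ i, ‖x i‖ ^ 2 ≤ ∑ _i : Fin n, (1 : ℝ) := Finset.sum_le_sum fun i _ => by
        have := hx i
        rw [Real.norm_eq_abs, sq_abs]
        nlinarith [this.1, this.2]
    _ = n := by simp

theorem convex_box (n : ℕ) : Convex ℝ (box n) := by
  intro x hx y hy s t hs ht hst i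
  exact (convex_Icc (-1 : ℝ) 1) (hx i) (hy i) hs ht hst

/-- The product of univariate sets, as a subset of Euclidean space. -/
def prodSet {n : ℕ} (S : Fin n → Set ℝ) : Set (EuclideanSpace ℝ (Fin n)) := {x | ∀ i, x i ∈ S i}

theorem measurableSet_prodSet {n : ℕ} {S : Fin n → Set ℝ} (hS : ∀ i, MeasurableSet (S i)) :
    MeasurableSet (prodSet S) := by
  have : prodSet S = ⋂ i, (fun x : EuclideanSpace ℝ (Fin n) => x i) ⁻¹' S i := by
    ext; simp [prodSet]
  rw [this]
  exact MeasurableSet.iInter fun i => (by fun_prop : Measurable _) (hS i)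

theorem integrableOn_prod_weight {n : ℕ} {l : ℝ} (hl : -1 < l) :
    IntegrableOn (fun x : EuclideanSpace ℝ (Fin n) => ∏ i, weight l (x i)) (box n) := by
  have h := PiLp.volume_preserving_ofLp (Fin n)
  have hbox : box n = (WithLp.ofLp) ⁻¹' (Set.univ.pi fun _ : Fin n => Set.Icc (-1 : ℝ) 1) := by
    ext x; simp only [box, Set.mem_preimage, Set.mem_univ_pi]; rfl
  rw [hbox]
  refine (h.integrableOn_comp_preimage
    (MeasurableEquiv.toLp 2 (Fin n → ℝ)).symm.measurableEmbedding
    (f := fun y : Fin n → ℝ => ∏ i, weight l (y i))).2 ?_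
  rw [IntegrableOn, volume_pi, Measure.restrict_pi_pi]
  exact Integrable.fintype_prod fun _ => integrableOn_weight hl

theorem setIntegral_prodSet_prod_weight {n : ℕ} (l : ℝ) (S : Fin n → Set ℝ) :
    ∫ x in prodSet S, ∏ i, weight l (x i) = ∏ i, ∫ x in S i, weight l x := by
  have h := PiLp.volume_preserving_ofLp (Fin n)
  have hS : prodSet S = (WithLp.ofLp) ⁻¹' (Set.univ.pi S) := by
    ext x; simp [prodSet]
  rw [hS, h.setIntegral_preimage_emb
    (MeasurableEquiv.toLp 2 (Fin n → ℝ)).symm.measurableEmbedding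
    (fun y : Fin n → ℝ => ∏ i, weight l (y i)), volume_pi, Measure.restrict_pi_pi]
  exact integral_fintype_prod_eq_prod (fun _ => weight l)

theorem boxMeasure_apply {n : ℕ} (l : ℝ) {E : Set (EuclideanSpace ℝ (Fin n))}
    (hE : MeasurableSet E) (hsub : E ⊆ box n) :
    boxMeasure n l E = ∫⁻ x in E, ENNReal.ofReal (∏ i, weight l (x i)) := by
  rw [boxMeasure, withDensity_apply _ hE, Measure.restrict_restrict hE,
    Set.inter_eq_left.2 hsub]
  rfl

theorem boxMeasure_real_apply {n : ℕ} (l : ℝ) {E : Set (EuclideanSpace ℝ (Fin n))}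
    (hE : MeasurableSet E) (hsub : E ⊆ box n) :
    (boxMeasure n l).real E = ∫ x in E, ∏ i, weight l (x i) := by
  rw [measureReal_def, boxMeasure_apply l hE hsub, integral_eq_lintegral_of_nonneg_ae]
  · filter_upwards [ae_restrict_mem hE] with x hx
    exact Finset.prod_nonneg fun i _ => weight_nonneg l (hsub hx i)
  · have : Measurable fun x : EuclideanSpace ℝ (Fin n) => ∏ i, weight l (x i) :=
      Finset.measurable_fun_prod _ fun i _ => (measurable_weight l).comp (by fun_prop)
    exact this.aestronglyMeasurable

theorem ae_boxMeasure_mem_box (n : ℕ) (l : ℝ) : ∀ᵐ x ∂boxMeasure n l, x ∈ box n :=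
  (withDensity_absolutelyContinuous _ _).ae_le (ae_restrict_mem (isClosed_box n).measurableSet)

theorem boxMeasure_restrict_box (n : ℕ) (l : ℝ) :
    (boxMeasure n l).restrict (box n) = boxMeasure n l :=
  Measure.restrict_eq_self_of_ae_mem (ae_boxMeasure_mem_box n l)

theorem isFiniteMeasure_boxMeasure (n : ℕ) {l : ℝ} (hl : -1 < l) :
    IsFiniteMeasure (boxMeasure n l) := by
  refine isFiniteMeasure_withDensity_ofReal ?_
  exact (integrableOn_prod_weight hl).hasFiniteIntegral

/-! ### The multivariate gauge and its doubling property. -/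

/-- The normalized sum of the univariate gauges of the distance to `a`. -/
def boxGauge {n : ℕ} (a x : EuclideanSpace ℝ (Fin n)) : ℝ :=
  (n + 1 : ℝ)⁻¹ * ∑ i, gauge (a i) (x i)

theorem continuous_boxGauge {n : ℕ} (a : EuclideanSpace ℝ (Fin n)) : Continuous (boxGauge a) := by
  unfold boxGauge
  have (i : Fin n) : Continuous fun x : EuclideanSpace ℝ (Fin n) => gauge (a i) (x i) :=
    (continuous_gauge _).comp (by fun_prop)
  fun_prop

theorem sum_gauge_eq {n : ℕ} (a x : EuclideanSpace ℝ (Fin n)) :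
    ∑ i, gauge (a i) (x i) = (n + 1) * boxGauge a x := by
  rw [boxGauge, mul_inv_cancel_left₀ (by positivity)]

theorem boxGauge_nonneg {n : ℕ} {a x : EuclideanSpace ℝ (Fin n)} (hx : x ∈ box n) :
    0 ≤ boxGauge a x :=
  mul_nonneg (by positivity) (Finset.sum_nonneg fun i _ => gauge_nonneg (hx i))

theorem boxGauge_le_of_forall {n : ℕ} {a x : EuclideanSpace ℝ (Fin n)} {t : ℝ} (ht : 0 ≤ t)
    (h : ∀ i, gauge (a i) (x i) ≤ t) : boxGauge a x ≤ t := by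
  have h1 : ∑ i, gauge (a i) (x i) ≤ n * t := by
    simpa using Finset.sum_le_card_nsmul Finset.univ (fun i => gauge (a i) (x i)) t fun i _ => h i
  rw [sum_gauge_eq] at h1
  have hn : (0 : ℝ) < n + 1 := by positivity
  refine le_of_mul_le_mul_left ?_ hn
  linarith

/-- This bound is the reason for the factor `(n + 1)⁻¹`: it puts `1 - boxGauge a x` in `[-1, 1]`,
where the Fejér estimates hold. Using `n + 1` also covers `n = 0`. -/
theorem boxGauge_le_two {n : ℕ} {a x : EuclideanSpace ℝ (Fin n)} (ha : a ∈ box n)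
    (hx : x ∈ box n) : boxGauge a x ≤ 2 :=
  boxGauge_le_of_forall (by norm_num) fun i => gauge_le_two (ha i) (hx i)

theorem gauge_le_boxGauge {n : ℕ} {a x : EuclideanSpace ℝ (Fin n)} (hx : x ∈ box n) (i : Fin n) :
    gauge (a i) (x i) ≤ (n + 1) * boxGauge a x := by
  rw [← sum_gauge_eq]
  exact Finset.single_le_sum (f := fun i => gauge (a i) (x i)) (fun j _ => gauge_nonneg (hx j))
    (Finset.mem_univ i)

theorem boxMeasure_real_gauge_le {n : ℕ} (l : ℝ) (a : EuclideanSpace ℝ (Fin n)) (t : ℝ) :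
    (boxMeasure n l).real (prodSet fun i => {x | x ∈ Set.Icc (-1 : ℝ) 1 ∧ gauge (a i) x ≤ t}) =
      ∏ i, sublevelMass l (gauge (a i)) t := by
  rw [boxMeasure_real_apply, setIntegral_prodSet_prod_weight]
  · rfl
  · exact measurableSet_prodSet fun i => measurableSet_Icc.inter
      (measurableSet_le (continuous_gauge _).measurable measurable_const)
  · exact fun x hx i => (hx i).1

/-- Up to a null set, the sublevel set at `t` lies between the products of the univariate sublevel
sets at `t` and at `(n + 1) * t`; the measure of a product factorizes. -/
theorem boxMeasure_boxGauge_doubling {n : ℕ} {l : ℝ} (hl : -1 < l) {a : EuclideanSpace ℝ (Fin n)}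
    (ha : a ∈ box n) :
    (∀ t > 0, 0 < (boxMeasure n l).real {x | boxGauge a x ≤ t}) ∧ ∃ D, 1 ≤ D ∧ ∀ t > 0,
      (boxMeasure n l).real {x | boxGauge a x ≤ 2 * t} ≤
        D * (boxMeasure n l).real {x | boxGauge a x ≤ t} := by
  have := isFiniteMeasure_boxMeasure n hl
  have hlow (t : ℝ) (ht : 0 < t) : ∏ i, sublevelMass l (gauge (a i)) t ≤
      (boxMeasure n l).real {x | boxGauge a x ≤ t} := by
    rw [← boxMeasure_real_gauge_le]
    exact measureReal_mono fun x hx => boxGauge_le_of_forall ht.le fun i => (hx i).2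
  have hup (t : ℝ) : (boxMeasure n l).real {x | boxGauge a x ≤ t} ≤
      ∏ i, sublevelMass l (gauge (a i)) ((n + 1) * t) := by
    rw [← boxMeasure_real_gauge_le, measureReal_def, measureReal_def]
    refine ENNReal.toReal_mono (measure_ne_top _ _) (measure_mono_ae ?_)
    filter_upwards [ae_boxMeasure_mem_box n l] with x hx hxt
    refine fun i => ⟨hx i, (gauge_le_boxGauge hx i).trans ?_⟩
    gcongr
    exact hxt
  have hpos (i : Fin n) := (sublevelMass_gauge_doubling hl (ha i)).1
  choose D hD1 hD using fun i => (sublevelMass_gauge_doubling hl (ha i)).2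
  have hiter (i : Fin n) (k : ℕ) (t : ℝ) (ht : 0 < t) :
      sublevelMass l (gauge (a i)) (2 ^ k * t) ≤ D i ^ k * sublevelMass l (gauge (a i)) t := by
    induction k with
    | zero => simp
    | succ k ih =>
      calc _ = sublevelMass l (gauge (a i)) (2 * (2 ^ k * t)) := by rw [pow_succ]; ring_nf
        _ ≤ D i * sublevelMass l (gauge (a i)) (2 ^ k * t) := hD i _ (by positivity)
        _ ≤ D i * (D i ^ k * sublevelMass l (gauge (a i)) t) := by
          have := hD1 i
          gcongr
        _ = _ := by ring
  refine ⟨fun t ht => (Finset.prod_pos fun i _ => hpos i t ht).trans_le (hlow t ht),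
    ∏ i, D i ^ (n + 1), Finset.one_le_prod fun i _ => one_le_pow₀ (hD1 i), fun t ht => ?_⟩
  calc _ ≤ ∏ i, sublevelMass l (gauge (a i)) ((n + 1) * (2 * t)) := hup _
    _ ≤ ∏ i, D i ^ (n + 1) * sublevelMass l (gauge (a i)) t := by
        refine Finset.prod_le_prod (fun i _ => (hpos i _ (by positivity)).le) fun i _ => ?_
        refine (sublevelMass_mono hl (continuous_gauge _).measurable ?_).trans
          (hiter i (n + 1) t ht)
        -- Hence `(n + 1) * (2 * t) ≤ 2 ^ (n + 1) * t`, and `n + 1` univariate doublings suffice.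
        have : (n + 1 : ℝ) ≤ 2 ^ n := by exact_mod_cast Nat.lt_two_pow_self
        rw [pow_succ, ← mul_assoc]
        gcongr
    _ = (∏ i, D i ^ (n + 1)) * ∏ i, sublevelMass l (gauge (a i)) t := Finset.prod_mul_distrib
    _ ≤ _ := by
        have : 0 ≤ ∏ i, D i ^ (n + 1) :=
          Finset.prod_nonneg fun i _ => pow_nonneg (zero_le_one.trans (hD1 i)) _
        gcongr
        exact hlow t ht

/-! ### Comparison of `f - f(a)` with the gauge. -/

theorem contDiff_polyFun {n : ℕ} (f : MvPolynomial (Fin n) ℝ) {k : WithTop ℕ∞} :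
    ContDiff ℝ k (polyFun f) := by
  unfold polyFun
  induction f using MvPolynomial.induction_on with
  | C r => simpa using contDiff_const
  | add p q hp hq => simpa using hp.add hq
  | mul_X p i hp =>
    simp only [map_mul, MvPolynomial.eval_X]
    exact hp.mul (by fun_prop)

theorem contDiff_gradient_polyFun {n : ℕ} (f : MvPolynomial (Fin n) ℝ) :
    ContDiff ℝ 1 (gradient (polyFun f)) := by
  have h : ContDiff ℝ 1 (fderiv ℝ (polyFun f)) :=
    (contDiff_polyFun f (k := 2)).fderiv_right (by norm_num)
  exact (InnerProductSpace.toDual ℝ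
    (EuclideanSpace ℝ (Fin n))).symm.toContinuousLinearEquiv.contDiff.comp h

theorem fderiv_polyFun_apply {n : ℕ} (f : MvPolynomial (Fin n) ℝ)
    (x v : EuclideanSpace ℝ (Fin n)) :
    fderiv ℝ (polyFun f) x v = ∑ i, gradient (polyFun f) x i * v i := by
  have : fderiv ℝ (polyFun f) x v = inner ℝ (gradient (polyFun f) x) v := by
    simp [gradient]
  rw [this, PiLp.inner_apply]
  simp [mul_comm]

theorem norm_gradient_le_gradConst {n : ℕ} (f : MvPolynomial (Fin n) ℝ)
    {x : EuclideanSpace ℝ (Fin n)} (hx : x ∈ box n) :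
    ‖gradient (polyFun f) x‖ ≤ gradConst (box n) f :=
  le_csSup ((isCompact_box n).bddAbove_image
    (contDiff_gradient_polyFun f).continuous.norm.continuousOn) (Set.mem_image_of_mem _ hx)

theorem norm_fderiv_gradient_le_hessConst {n : ℕ} (f : MvPolynomial (Fin n) ℝ)
    {x : EuclideanSpace ℝ (Fin n)} (hx : x ∈ box n) :
    ‖fderiv ℝ (gradient (polyFun f)) x‖ ≤ 2 * hessConst (box n) f := by
  have := le_csSup ((isCompact_box n).bddAbove_image
    ((contDiff_gradient_polyFun f).continuous_fderiv one_ne_zero).norm.continuousOn)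
    (Set.mem_image_of_mem _ hx)
  rw [hessConst]
  linarith

/-- Two applications of the mean value inequality, to the gradient and then to `f`, on the segment
from `a` to `x`. This loses a factor `2` against Taylor's formula, which is harmless here. -/
theorem abs_polyFun_sub_le {n : ℕ} (f : MvPolynomial (Fin n) ℝ)
    {a x : EuclideanSpace ℝ (Fin n)} (ha : a ∈ box n) (hx : x ∈ box n) :
    |polyFun f x - polyFun f a - fderiv ℝ (polyFun f) a (x - a)| ≤
      2 * hessConst (box n) f * ‖x - a‖ ^ 2 := by
  set H := hessConst (box n) f
  have hH : 0 ≤ 2 * H := (norm_nonneg _).trans (norm_fderiv_gradient_le_hessConst f ha)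
  have hsub : segment ℝ a x ⊆ box n := (convex_box n).segment_subset ha hx
  have hbound : ∀ y ∈ segment ℝ a x,
      ‖fderiv ℝ (polyFun f) y - fderiv ℝ (polyFun f) a‖ ≤ 2 * H * ‖x - a‖ := by
    intro y hy
    have h1 : ‖gradient (polyFun f) y - gradient (polyFun f) a‖ ≤ 2 * H * ‖y - a‖ :=
      (convex_box n).norm_image_sub_le_of_norm_fderiv_le (𝕜 := ℝ)
        (fun z _ => (contDiff_gradient_polyFun f).differentiable one_ne_zero z)
        (fun z hz => norm_fderiv_gradient_le_hessConst f hz) ha (hsub hy)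
    have h2 : ‖fderiv ℝ (polyFun f) y - fderiv ℝ (polyFun f) a‖
        = ‖gradient (polyFun f) y - gradient (polyFun f) a‖ := by
      rw [gradient, gradient, ← map_sub, LinearIsometryEquiv.norm_map]
    rw [h2]
    refine h1.trans ?_
    gcongr
    exact norm_sub_le_of_mem_segment hy
  have := (convex_segment a x).norm_image_sub_le_of_norm_fderiv_le' (𝕜 := ℝ)
    (fun z _ => (contDiff_polyFun f (k := 1)).differentiable one_ne_zero z) hbound
    (left_mem_segment ℝ a x) (right_mem_segment ℝ a x)
  rw [Real.norm_eq_abs] at this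
  linarith

/-- Moving along the `i`-th axis stays in the box for small steps, so the one-variable slice has a
local minimum at `0`. -/
theorem gradient_apply_eq_zero_of_isMinOn {n : ℕ} {f : MvPolynomial (Fin n) ℝ}
    {a : EuclideanSpace ℝ (Fin n)} (hmin : IsMinOn (polyFun f) (box n) a) (ha : a ∈ box n)
    {i : Fin n} (hi : |a i| < 1) : gradient (polyFun f) a i = 0 := by
  set e := EuclideanSpace.single i (1 : ℝ)
  have hder : HasDerivAt (fun s : ℝ => polyFun f (a + s • e)) (fderiv ℝ (polyFun f) a e) 0 := by
    have h1 : HasFDerivAt (polyFun f) (fderiv ℝ (polyFun f) a) (a + (0 : ℝ) • e) := by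
      simpa using ((contDiff_polyFun f (k := 1)).differentiable one_ne_zero a).hasFDerivAt
    have h2 : HasDerivAt (fun s : ℝ => a + s • e) e 0 := by
      simpa using ((hasDerivAt_id (0 : ℝ)).smul_const e).const_add a
    exact h1.comp_hasDerivAt 0 h2
  have hloc : IsLocalMin (fun s : ℝ => polyFun f (a + s • e)) 0 := by
    have hnhds : ∀ᶠ s : ℝ in nhds 0, |s| < 1 - |a i| := by
      have : Filter.Tendsto (fun s : ℝ => |s|) (nhds 0) (nhds 0) := by
        simpa using (continuous_abs (G := ℝ)).tendsto 0
      exact this.eventually_lt_const (by linarith)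
    filter_upwards [hnhds] with s hs
    simp only [zero_smul, add_zero]
    refine hmin fun j => ?_
    by_cases hj : j = i
    · subst hj
      have := abs_add_le (a j) s
      have h3 : |a j + s| ≤ 1 := by linarith
      simpa [e] using abs_le.1 h3
    · simpa [e, hj] using ha j
  have h0 := hloc.hasDerivAt_eq_zero hder
  rw [fderiv_polyFun_apply, Finset.sum_eq_single i] at h0
  · simpa [e] using h0
  · intro j _ hj
    simp [e, hj]
  · simp

/-- In the linear term, interior coordinates vanish and boundary coordinates are controlled by the
linear gauge. The quadratic remainder is absorbed through `(x - a) ^ 2 ≤ 2 * gauge a x`, valid in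
both cases. -/
theorem polyFun_sub_le_boxGauge {n : ℕ} {f : MvPolynomial (Fin n) ℝ}
    {a x : EuclideanSpace ℝ (Fin n)} (hmin : IsMinOn (polyFun f) (box n) a) (ha : a ∈ box n)
    (hx : x ∈ box n) :
    polyFun f x - polyFun f a ≤
      (gradConst (box n) f + 4 * hessConst (box n) f) * (n + 1) * boxGauge a x := by
  set β := gradConst (box n) f
  set H := hessConst (box n) f
  have hβ : 0 ≤ β := (norm_nonneg _).trans (norm_gradient_le_gradConst f ha)
  have hH : 0 ≤ 2 * H := (norm_nonneg _).trans (norm_fderiv_gradient_le_hessConst f ha)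
  have h1 := (abs_le.1 (abs_polyFun_sub_le f ha hx)).2
  have h2 : fderiv ℝ (polyFun f) a (x - a) ≤ β * ∑ i, gauge (a i) (x i) := by
    rw [fderiv_polyFun_apply, Finset.mul_sum]
    refine Finset.sum_le_sum fun i _ => ?_
    rcases lt_or_eq_of_le (abs_le.2 (ha i)) with hi | hi
    · rw [gradient_apply_eq_zero_of_isMinOn hmin ha hi, zero_mul]
      exact mul_nonneg hβ (gauge_nonneg (hx i))
    · calc _ ≤ |gradient (polyFun f) a i| * |x i - a i| := by
            rw [← abs_mul]; exact le_abs_self _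
        _ ≤ β * gauge (a i) (x i) := by
            gcongr
            · exact (PiLp.norm_apply_le (gradient (polyFun f) a) i).trans
                (norm_gradient_le_gradConst f ha)
            · exact abs_sub_le_gauge hi (hx i)
  have h3 : ‖x - a‖ ^ 2 ≤ 2 * ∑ i, gauge (a i) (x i) := by
    rw [EuclideanSpace.norm_sq_eq, Finset.mul_sum]
    refine Finset.sum_le_sum fun i _ => ?_
    rw [Real.norm_eq_abs, sq_abs]
    exact sq_sub_le_two_mul_gauge (hx i)
  have h4 := mul_le_mul_of_nonneg_left h3 hH
  rw [mul_assoc, ← sum_gauge_eq]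
  linarith

/-! ### Polynomial densities and the error bound. -/

/-- The polynomial `1 - boxGauge a`. -/
def coGaugePoly {n : ℕ} (a : EuclideanSpace ℝ (Fin n)) : MvPolynomial (Fin n) ℝ :=
  1 - MvPolynomial.C ((n + 1 : ℝ)⁻¹) * ∑ i, if |a i| = 1 then
    1 - MvPolynomial.C (a i) * MvPolynomial.X i
    else MvPolynomial.C (1 / 2) * (MvPolynomial.X i - MvPolynomial.C (a i)) ^ 2

theorem polyFun_coGaugePoly {n : ℕ} (a x : EuclideanSpace ℝ (Fin n)) :
    polyFun (coGaugePoly a) x = 1 - boxGauge a x := by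
  simp only [polyFun, coGaugePoly, boxGauge, gauge, map_sub, map_mul, map_sum, map_one,
    MvPolynomial.eval_C]
  congr 2
  refine Finset.sum_congr rfl fun i _ => ?_
  split_ifs
  · simp
  · simp; ring

theorem totalDegree_coGaugePoly_le {n : ℕ} (a : EuclideanSpace ℝ (Fin n)) :
    (coGaugePoly a).totalDegree ≤ 2 := by
  refine (MvPolynomial.totalDegree_sub _ _).trans (max_le (by simp) ?_)
  refine (MvPolynomial.totalDegree_mul _ _).trans ?_
  rw [MvPolynomial.totalDegree_C, zero_add]
  refine MvPolynomial.totalDegree_finsetSum_le fun i _ => ?_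
  split_ifs
  · refine (MvPolynomial.totalDegree_sub _ _).trans (max_le (by simp) ?_)
    refine (MvPolynomial.totalDegree_mul _ _).trans ?_
    simp [MvPolynomial.totalDegree_X]
  · refine (MvPolynomial.totalDegree_mul _ _).trans ?_
    rw [MvPolynomial.totalDegree_C, zero_add]
    refine (MvPolynomial.totalDegree_pow _ _).trans ?_
    have : (MvPolynomial.X i - MvPolynomial.C (a i)).totalDegree ≤ 1 :=
      (MvPolynomial.totalDegree_sub _ _).trans (max_le (by simp) (by simp))
    omega

theorem totalDegree_aeval_le {σ R : Type*} [CommRing R] (Q : Polynomial R)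
    (p : MvPolynomial σ R) :
    (Polynomial.aeval p Q).totalDegree ≤ Q.natDegree * p.totalDegree := by
  rw [Polynomial.aeval_eq_sum_range]
  refine MvPolynomial.totalDegree_finsetSum_le fun i hi => ?_
  refine (MvPolynomial.totalDegree_smul_le _ _).trans ?_
  refine (MvPolynomial.totalDegree_pow _ _).trans ?_
  exact Nat.mul_le_mul_right _ (by simpa [Nat.lt_succ_iff] using hi)

theorem polyFun_aeval {n : ℕ} (Q : Polynomial ℝ) (p : MvPolynomial (Fin n) ℝ)
    (x : EuclideanSpace ℝ (Fin n)) :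
    polyFun (Polynomial.aeval p Q) x = Q.eval (polyFun p x) := by
  unfold polyFun
  rw [← MvPolynomial.coe_aeval_eq_eval, RingHom.coe_coe, ← Polynomial.aeval_algHom_apply,
    Polynomial.coe_aeval_eq_eval]

theorem polyFun_nonneg_of_isSumSq {n : ℕ} {q : MvPolynomial (Fin n) ℝ} (hq : IsSumSq q)
    (x : EuclideanSpace ℝ (Fin n)) : 0 ≤ polyFun q x := by
  induction hq with
  | zero => simp [polyFun]
  | sq_add p _ ih =>
    simp only [polyFun, map_add, map_mul] at ih ⊢
    exact add_nonneg (mul_self_nonneg _) ih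

theorem integrable_of_continuous {n : ℕ} {l : ℝ} (hl : -1 < l)
    {F : EuclideanSpace ℝ (Fin n) → ℝ} (hF : Continuous F) : Integrable F (boxMeasure n l) := by
  have := isFiniteMeasure_boxMeasure n hl
  rw [← boxMeasure_restrict_box]
  exact hF.continuousOn.integrableOn_compact (isCompact_box n)

theorem continuous_polyFun {n : ℕ} (f : MvPolynomial (Fin n) ℝ) : Continuous (polyFun f) :=
  (contDiff_polyFun f (k := 1)).continuous

theorem minValue_eq {n : ℕ} {K : Set (EuclideanSpace ℝ (Fin n))} {f : MvPolynomial (Fin n) ℝ}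
    {a : EuclideanSpace ℝ (Fin n)} (ha : a ∈ K) (hmin : IsMinOn (polyFun f) K a) :
    minValue K f = polyFun f a := by
  refine IsLeast.csInf_eq ⟨Set.mem_image_of_mem _ ha, ?_⟩
  rintro _ ⟨x, hx, rfl⟩
  exact hmin hx

/-- The error is at most the integral of `f - f(a)` against any normalized density in the
feasible set. -/
theorem ubError_le {n r : ℕ} {l : ℝ} (hl : -1 < l) {f q : MvPolynomial (Fin n) ℝ}
    {a : EuclideanSpace ℝ (Fin n)} (ha : a ∈ box n) (hmin : IsMinOn (polyFun f) (box n) a)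
    (hq : q ∈ sosPolys n r) (hq1 : ∫ x, polyFun q x ∂boxMeasure n l = 1) :
    ubError (box n) (boxMeasure n l) f r ≤
      ∫ x, (polyFun f x - polyFun f a) * polyFun q x ∂boxMeasure n l := by
  have hint (p : MvPolynomial (Fin n) ℝ) : Integrable (fun x => polyFun f x * polyFun p x)
      (boxMeasure n l) :=
    integrable_of_continuous hl ((continuous_polyFun f).mul (continuous_polyFun p))
  have hint' (p : MvPolynomial (Fin n) ℝ) : Integrable (fun x => polyFun f a * polyFun p x)
      (boxMeasure n l) :=
    integrable_of_continuous hl (continuous_const.mul (continuous_polyFun p))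
  rw [ubError, minValue_eq ha hmin, upperBound, boxMeasure_restrict_box]
  have heq : ∫ x, (polyFun f x - polyFun f a) * polyFun q x ∂boxMeasure n l =
      (∫ x, polyFun f x * polyFun q x ∂boxMeasure n l) - polyFun f a := by
    simp_rw [sub_mul]
    rw [integral_sub (hint q) (hint' q), integral_const_mul, hq1, mul_one]
  rw [heq]
  refine sub_le_sub_right (csInf_le ?_ ?_) _
  swap
  · exact ⟨q, hq, hq1, rfl⟩
  -- `csInf_le` needs the set of admissible values to be bounded below; `f(a)` is such a bound since
  -- densities are nonnegative.
  refine ⟨polyFun f a, ?_⟩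
  rintro _ ⟨p, hp, hp1, rfl⟩
  calc polyFun f a = ∫ x, polyFun f a * polyFun p x ∂boxMeasure n l := by
        rw [integral_const_mul, hp1, mul_one]
    _ ≤ _ := by
        refine integral_mono_ae (hint' p) (hint p) ?_
        filter_upwards [ae_boxMeasure_mem_box n l] with x hx
        exact mul_le_mul_of_nonneg_right (hmin hx) (polyFun_nonneg_of_isSumSq hp.1 x)

/-- Sums of squares of degree `2 r` concentrate around `a` at scale `1 / r²`, as measured by
`boxGauge a`. -/
theorem exists_sosPolys_integral_boxGauge_le {n : ℕ} {l : ℝ} (hl : -1 < l)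
    {a : EuclideanSpace ℝ (Fin n)} (ha : a ∈ box n) :
    ∃ C > 0, ∀ r : ℕ, 1 ≤ r → ∃ q ∈ sosPolys n r, ∫ x, polyFun q x ∂boxMeasure n l = 1 ∧
      ∫ x, boxGauge a x * polyFun q x ∂boxMeasure n l ≤ C / (r : ℝ) ^ 2 := by
  have := isFiniteMeasure_boxMeasure n hl
  obtain ⟨hpos, D, hD, hdoub⟩ := boxMeasure_boxGauge_doubling hl ha
  obtain ⟨s, hs, C, hC, hconc⟩ := exists_integral_mul_pow_le
    (continuous_boxGauge a).measurable
    (by filter_upwards [ae_boxMeasure_mem_box n l] with x hx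
        using ⟨boxGauge_nonneg hx, boxGauge_le_two ha hx⟩) hD hdoub
  refine ⟨C * (4 * s ^ 2), by positivity, fun r hr => ?_⟩
  -- The largest `m` with `2 * s * (m - 1) ≤ r`: the degree constraint holds because `Q` has degree
  -- at most `m - 1` and the gauge degree at most `2`, while `r ≤ 2 * s * m` gives the rate.
  set m := r / (2 * s) + 1 with hm
  have hm1 : 1 ≤ m := Nat.le_add_left 1 _
  have hm0 : (0 : ℝ) < m := by exact_mod_cast hm1
  obtain ⟨Q, hQdeg, hQ⟩ := exists_fejer_polynomial hm1
  set P := Polynomial.aeval (coGaugePoly a) Q with hP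
  have hPval (x : EuclideanSpace ℝ (Fin n)) : polyFun P x = Q.eval (1 - boxGauge a x) := by
    rw [hP, polyFun_aeval, polyFun_coGaugePoly]
  set δ : ℝ := 1 / (m : ℝ) ^ 2 with hδ
  have hδ0 : 0 < δ := by positivity
  set g : EuclideanSpace ℝ (Fin n) → ℝ := fun x => polyFun P x * δ with hg
  have hgcont : Continuous g := (continuous_polyFun P).mul continuous_const
  have hδm : (m : ℝ) ^ 2 * δ = 1 := by rw [hδ]; field_simp
  obtain ⟨hle, hlow⟩ := hconc δ hδ0 g hgcont.measurable (by
    filter_upwards [ae_boxMeasure_mem_box n l] with x hx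
    obtain ⟨h1, h2, h3, h4⟩ := hQ (1 - boxGauge a x)
      ⟨by linarith [boxGauge_le_two ha hx], by linarith [boxGauge_nonneg (a := a) hx]⟩
    simp only [hg, hPval]
    refine ⟨mul_nonneg h1 hδ0.le, ?_, ?_, fun h => ?_⟩
    · calc _ ≤ (m : ℝ) ^ 2 * δ := by gcongr
        _ = 1 := hδm
    · rw [sub_sub_cancel] at h3
      calc _ = (Q.eval (1 - boxGauge a x) * boxGauge a x) * δ := by ring
        _ ≤ 2 * δ := by gcongr
    · have h5 := h4 (by rwa [sub_sub_cancel])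
      calc (1 / 4 : ℝ) = (m : ℝ) ^ 2 / 4 * δ := by rw [div_mul_eq_mul_div, hδm]
        _ ≤ _ := by gcongr)
  set I := ∫ x, g x ^ (2 * s) ∂boxMeasure n l with hI
  have hI0 : 0 < I := lt_of_lt_of_le (by have := hpos δ hδ0; positivity) hlow
  -- The scalar is chosen so that `p * p` equals `g ^ (2 * s) / I`, a single square of integral one.
  set p : MvPolynomial (Fin n) ℝ := MvPolynomial.C (δ ^ s / √I) * P ^ s with hp
  have hpval (x : EuclideanSpace ℝ (Fin n)) : polyFun (p * p) x = g x ^ (2 * s) / I := by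
    have h1 : polyFun (p * p) x = (δ ^ s / √I * polyFun P x ^ s) ^ 2 := by
      simp [polyFun, hp, sq]
    rw [h1, mul_pow, div_pow, Real.sq_sqrt hI0.le, hg, mul_pow, pow_mul', pow_mul']
    ring
  refine ⟨p * p, ⟨IsSumSq.mul_self p, ?_⟩, ?_, ?_⟩
  · have h1 : P.totalDegree ≤ r / (2 * s) * 2 :=
      (totalDegree_aeval_le _ _).trans
        (Nat.mul_le_mul (by omega) (totalDegree_coGaugePoly_le a))
    have h2 : p.totalDegree ≤ r := by
      refine (MvPolynomial.totalDegree_mul _ _).trans ?_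
      rw [MvPolynomial.totalDegree_C, zero_add]
      refine (MvPolynomial.totalDegree_pow _ _).trans ?_
      calc s * P.totalDegree ≤ s * (r / (2 * s) * 2) := Nat.mul_le_mul_left _ h1
        _ = r / (2 * s) * (2 * s) := by ring
        _ ≤ r := Nat.div_mul_le_self _ _
    have h3 := MvPolynomial.totalDegree_mul p p
    omega
  · simp_rw [hpval]
    rw [integral_div, ← hI, div_self hI0.ne']
  · simp_rw [hpval, mul_div_assoc']
    rw [integral_div, div_le_iff₀ hI0]
    refine hle.trans ?_
    gcongr
    rw [hδ, mul_one_div, div_le_div_iff₀ (by positivity) (by positivity), mul_assoc]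
    gcongr
    have h1 : r ≤ 2 * s * m := by
      rw [hm]
      have := Nat.lt_mul_div_succ r (b := 2 * s) (by omega)
      exact this.le
    have h2 : (r : ℝ) ≤ 2 * s * m := by exact_mod_cast h1
    calc (r : ℝ) ^ 2 ≤ (2 * s * m) ^ 2 := by gcongr
      _ = _ := by ring

end Lasserre

end

theorem mainTheorem1 (n : ℕ) (l : ℝ) (hl : -(1 / 2 : ℝ) ≤ l)
    (a : EuclideanSpace ℝ (Fin n)) (ha : a ∈ Lasserre.box n) (B G : ℝ) :
    ∃ c : ℝ, 0 < c ∧ ∀ f : MvPolynomial (Fin n) ℝ,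
      IsMinOn (Lasserre.polyFun f) (Lasserre.box n) a →
      Lasserre.gradConst (Lasserre.box n) f = B →
      Lasserre.hessConst (Lasserre.box n) f = G →
      ∀ r : ℕ, 1 ≤ r →
        Lasserre.ubError (Lasserre.box n) (Lasserre.boxMeasure n l) f r ≤ c / (r : ℝ) ^ 2 := by
  have hl1 : -1 < l := by linarith
  obtain ⟨C, hC, hex⟩ := Lasserre.exists_sosPolys_integral_boxGauge_le hl1 ha
  -- Absolute values and the `+ 1` make the constant positive for arbitrary real `B` and `G`,
  -- including zero.
  refine ⟨(|B| + 4 * |G| + 1) * (n + 1) * C, by positivity, fun f hmin hB hG r hr => ?_⟩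
  obtain ⟨q, hq, hq1, hqC⟩ := hex r hr
  have hcg : Continuous fun x => Lasserre.boxGauge a x * Lasserre.polyFun q x :=
    (Lasserre.continuous_boxGauge a).mul (Lasserre.continuous_polyFun q)
  have hcf : Continuous fun x =>
      (Lasserre.polyFun f x - Lasserre.polyFun f a) * Lasserre.polyFun q x :=
    ((Lasserre.continuous_polyFun f).sub continuous_const).mul (Lasserre.continuous_polyFun q)
  calc _ ≤ ∫ x, (Lasserre.polyFun f x - Lasserre.polyFun f a) * Lasserre.polyFun q x
          ∂Lasserre.boxMeasure n l := Lasserre.ubError_le hl1 ha hmin hq hq1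
    _ ≤ ∫ x, (|B| + 4 * |G| + 1) * (n + 1) * (Lasserre.boxGauge a x * Lasserre.polyFun q x)
          ∂Lasserre.boxMeasure n l := by
        refine integral_mono_ae (Lasserre.integrable_of_continuous hl1 hcf)
          ((Lasserre.integrable_of_continuous hl1 hcg).const_mul _) ?_
        filter_upwards [Lasserre.ae_boxMeasure_mem_box n l] with x hx
        rw [← mul_assoc]
        refine mul_le_mul_of_nonneg_right ?_ (Lasserre.polyFun_nonneg_of_isSumSq hq.1 x)
        refine (Lasserre.polyFun_sub_le_boxGauge hmin ha hx).trans ?_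
        have := Lasserre.boxGauge_nonneg (a := a) hx
        rw [hB, hG]
        have hBG : B + 4 * G ≤ |B| + 4 * |G| + 1 := by linarith [le_abs_self B, le_abs_self G]
        exact mul_le_mul_of_nonneg_right (mul_le_mul_of_nonneg_right hBG (by positivity)) this
    _ ≤ (|B| + 4 * |G| + 1) * (n + 1) * (C / (r : ℝ) ^ 2) := by
        rw [integral_const_mul]
        gcongr
    _ = _ := by ring
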